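/- Let $\xi_1,\xi_2,\dots$ be independent, identically distributed real random variables with common law that of $\xi$, with $\mathbb E|\xi|<\infty$ and $\mathbb E\xi=-a<0$. Let $S_0=0$, $S_n=\xi_1+\dots+\xi_n$, and let $\tau=\min\{n\ge1: S_n\le0\}$ be the first descending ladder epoch of the random walk (with $\tau=\infty$ if there is no such $n$). Assume that $\mathbb E e^{c\xi}=\infty$ for every $c>0$. Let $g:\mathbb R\to\mathbb R$ be nonnegative and nondecreasing on $\mathbb R$, and differentiable at all sufficiently large $x$, with $\lim_{x\to\infty}g'(x)=0$. Suppose that there are $\gamma\in(0,1)$, $x_0>0$ and $A>0$ such that $$\int_1^\infty e^{-(1-\gamma)g(x)}\,dx<\infty$$ and $$g(x)-g(x-y)\le\gamma g(y)+A\qquad\text{whenever } x_0<y\le x/2 .$$ If $\mathbb E\exp(g(\xi))<\infty$, then $\tau<\infty$ almost surely and $$\mathbb E\exp\bigl((1-\varepsilon)\,g((a-\delta)\tau)\bigr)<\infty\qquad\text{for all }\varepsilon\in(0,1)\text{ and }\delta\in(0,a).$$ -/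

import Mathlib

open MeasureTheory ProbabilityTheory Filter Topology Set

open scoped ENNReal

/-- The random walk `S_n = ξ_1 + ⋯ + ξ_n` (so `S_0 = 0`); the increments are indexed from `0`,
that is, `ξ k` is the `(k+1)`-st increment. -/
def walk {Ω : Type*} (ξ : ℕ → Ω → ℝ) (n : ℕ) (ω : Ω) : ℝ :=
  ∑ k ∈ Finset.range n, ξ k ω

/-- The first descending ladder epoch `τ = min {n ≥ 1 : S_n ≤ 0}`, with value `⊤` if the walk stays
positive at all times `n ≥ 1`. -/
noncomputable def ladderEpoch {Ω : Type*} (ξ : ℕ → Ω → ℝ) (ω : Ω) : ℕ∞ :=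
  sInf ((fun n : ℕ => (n : ℕ∞)) '' {n : ℕ | 1 ≤ n ∧ walk ξ n ω ≤ 0})

/-!
Fix `0 < b < a` and let `U n = S n + b n`, a walk whose increments `X` have mean `b - a < 0`. As
long as `n < τ` one has `U n > b n`, so `{τ > n}` is contained in the event that `U` reaches the
level `b n` before it becomes negative. This event is controlled by a Lyapunov function adapted to
a target `x` slightly above the level, the integrated tail
`W u = ∫ t in max (x - u) r..x + L, exp (-g t)` (`integratedTail`).

Let `s = x - u`. A jump `y` changes `W` by at most `exp (-g s)` times `jumpBound`, which is `y` up
to small errors (`integratedTail_add_sub_le`). Since `g' → 0`, the integrand is almost constant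
near `s`. Larger jumps are handled by `g s - g (s - y) ≤ γ g y + A`, applied either to `y` or to
`t = s - y`, whichever is at most `s / 2` (`integral_exp_neg_jump_le`). The resulting errors are
integrable: `y exp (γ g y)` is at most a constant times `exp (g y)`, because integrability of
`exp (-(1 - γ) g)` forces `y ≤ C exp ((1 - γ) g y)` (`exists_forall_le_mul_exp`), and in the second
case the error is `exp (g y)` times a small tail of that integral. By dominated convergence the
expected change of `W` is therefore negative for suitable parameters, at distance at least `R` from
the target (`exists_integratedTail_superharmonic`).

The maximal inequality `mul_measure_walk_pos_le` then bounds `P (τ > n)` by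
`W 0 / W (x - R)`, which is of order `exp (-g (b n + R))`. This gives
`P (τ ≥ m) ≤ C exp (-g (b m))` (`exists_measure_le_ladderEpoch_le`). As `g → ∞`, it follows that
`τ < ∞` almost surely; and since `P (g (b τ) ≥ k) ≤ C exp (-k)` for every level `k`, the exponential
moments of `g (b τ)` of every order less than `1` are finite (`lintegral_exp_mul_lt_top`).
-/

/-! ### Growth of `g` -/

theorem exists_forall_add_le_add_mul {g : ℝ → ℝ}
    (hg_diff : ∀ᶠ x in atTop, DifferentiableAt ℝ g x)
    (hg_deriv : Tendsto (deriv g) atTop (𝓝 0)) {η : ℝ} (hη : 0 < η) :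
    ∃ T, ∀ t h, T ≤ t → 0 ≤ h → g (t + h) ≤ g t + η * h := by
  obtain ⟨T, hT⟩ := eventually_atTop.1 (hg_diff.and (hg_deriv.eventually (gt_mem_nhds hη)))
  refine ⟨T, fun t h ht hh => ?_⟩
  have := (convex_Ici T).image_sub_le_mul_sub_of_deriv_le (f := g) (C := η)
    (fun x hx => (hT x hx).1.continuousAt.continuousWithinAt)
    (fun x hx => (hT x (interior_subset hx)).1.differentiableWithinAt)
    (fun x hx => (hT x (interior_subset hx)).2.le) t ht (t + h)
    (le_add_of_le_of_nonneg ht hh) (by linarith)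
  linarith

theorem exists_forall_add_le_add_const {g : ℝ → ℝ} (hg_nonneg : ∀ x, 0 ≤ g x)
    (hg_mono : Monotone g) (hg_diff : ∀ᶠ x in atTop, DifferentiableAt ℝ g x)
    (hg_deriv : Tendsto (deriv g) atTop (𝓝 0)) {b : ℝ} (hb : 0 ≤ b) :
    ∃ C, ∀ t, g (t + b) ≤ g t + C := by
  obtain ⟨T, hT⟩ := exists_forall_add_le_add_mul hg_diff hg_deriv one_pos
  refine ⟨g (T + b) + b, fun t => ?_⟩
  rcases le_total T t with h | h
  · linarith [hT t b h hb, hg_nonneg (T + b)]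
  · linarith [hg_mono (add_le_add_left h b), hg_nonneg t]

/-- Monotonicity turns integrability of `exp (-β g)` into at least logarithmic growth of `g`. -/
theorem exists_forall_le_mul_exp {g : ℝ → ℝ} (hg_mono : Monotone g) {β : ℝ} (hβ : 0 < β)
    (hI : IntegrableOn (fun x => Real.exp (-β * g x)) (Ioi 1)) :
    ∃ C, 0 < C ∧ ∀ y, 2 ≤ y → y ≤ C * Real.exp (β * g y) := by
  set I := ∫ x in Ioi (1 : ℝ), Real.exp (-β * g x)
  have hI0 : 0 ≤ I := integral_nonneg fun _ => (Real.exp_pos _).le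
  refine ⟨2 * (I + 1), by positivity, fun y hy => ?_⟩
  have h1 : (y - 1) * Real.exp (-β * g y) ≤ I := by
    calc (y - 1) * Real.exp (-β * g y) = ∫ _ in Ioc 1 y, Real.exp (-β * g y) := by
          rw [setIntegral_const, Measure.real, Real.volume_Ioc,
            ENNReal.toReal_ofReal (by linarith), smul_eq_mul]
      _ ≤ ∫ x in Ioc 1 y, Real.exp (-β * g x) := by
          refine setIntegral_mono_on (by simp) (hI.mono_set Ioc_subset_Ioi_self)
            measurableSet_Ioc fun x hx => ?_
          have := hg_mono hx.2
          simp only [Real.exp_le_exp]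
          nlinarith
      _ ≤ I := setIntegral_mono_set hI (ae_of_all _ fun _ => (Real.exp_pos _).le)
          (LE.le.eventuallyLE Ioc_subset_Ioi_self)
  have h2 : Real.exp (-β * g y) * Real.exp (β * g y) = 1 := by
    rw [← Real.exp_add]; simp
  have h3 : y - 1 ≤ I * Real.exp (β * g y) := by
    calc y - 1 = (y - 1) * Real.exp (-β * g y) * Real.exp (β * g y) := by
          rw [mul_assoc, h2, mul_one]
      _ ≤ _ := by gcongr
  nlinarith [Real.exp_pos (β * g y)]

theorem tendsto_atTop_of_integrableOn_exp {g : ℝ → ℝ} (hg_mono : Monotone g) {β : ℝ}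
    (hβ : 0 < β) (hI : IntegrableOn (fun x => Real.exp (-β * g x)) (Ioi 1)) :
    Tendsto g atTop atTop := by
  obtain ⟨C, hC, h⟩ := exists_forall_le_mul_exp hg_mono hβ hI
  refine tendsto_atTop_mono' (f₁ := fun y => Real.log (y / C) / β) atTop ?_ ?_
  · filter_upwards [eventually_ge_atTop 2] with y hy
    rw [div_le_iff₀ hβ, mul_comm, Real.log_le_iff_le_exp (by positivity), div_le_iff₀ hC, mul_comm]
    exact h y hy
  · exact (Real.tendsto_log_atTop.comp (tendsto_id.atTop_div_const hC)).atTop_div_const hβ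

/-! ### The integrated tail as a Lyapunov function -/

section Drift

/-- The integrated tail `∫ exp (-g t) dt` over `x - u < t ≤ z`, with the range of integration cut
off below at `r`. As a function of the position `u` it is the Lyapunov function of a walk that aims
at the level `x`; for `z = x + L` its value at `0` is of order `exp (-g x)`. -/
noncomputable def integratedTail (g : ℝ → ℝ) (r z x u : ℝ) : ℝ :=
  ∫ t in (min (max (x - u) r) z)..z, Real.exp (-g t)

theorem antitone_exp_neg {g : ℝ → ℝ} (hg_mono : Monotone g) :
    Antitone fun t => Real.exp (-g t) := fun _ _ h =>
  Real.exp_le_exp.2 (neg_le_neg (hg_mono h))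

theorem intervalIntegrable_exp_neg {g : ℝ → ℝ} (hg_mono : Monotone g) (a b : ℝ) :
    IntervalIntegrable (fun t => Real.exp (-g t)) volume a b :=
  (antitone_exp_neg hg_mono).intervalIntegrable

theorem integratedTail_sub {g : ℝ → ℝ} (hg_mono : Monotone g) (r z x u v : ℝ) :
    integratedTail g r z x v - integratedTail g r z x u =
      ∫ t in (min (max (x - v) r) z)..(min (max (x - u) r) z), Real.exp (-g t) := by
  unfold integratedTail
  rw [← intervalIntegral.integral_add_adjacent_intervals
    (intervalIntegrable_exp_neg hg_mono (min (max (x - v) r) z) (min (max (x - u) r) z))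
    (intervalIntegrable_exp_neg hg_mono _ z)]
  ring

theorem integratedTail_mono {g : ℝ → ℝ} (hg_mono : Monotone g) (r z x : ℝ) :
    Monotone (integratedTail g r z x) := by
  intro u v huv
  rw [← sub_nonneg, integratedTail_sub hg_mono]
  exact intervalIntegral.integral_nonneg (by gcongr) fun _ _ => (Real.exp_pos _).le

theorem integratedTail_nonneg (g : ℝ → ℝ) (r z x u : ℝ) : 0 ≤ integratedTail g r z x u :=
  intervalIntegral.integral_nonneg (min_le_right _ _) fun _ _ => (Real.exp_pos _).le

theorem integratedTail_le {g : ℝ → ℝ} (hg_mono : Monotone g) (r z x u : ℝ) :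
    integratedTail g r z x u ≤ ∫ t in (min r z)..z, Real.exp (-g t) := by
  have hle : min r z ≤ min (max (x - u) r) z := min_le_min_right z (le_max_right _ _)
  exact intervalIntegral.integral_mono_interval hle (min_le_right _ _) le_rfl
    (ae_of_all _ fun _ => (Real.exp_pos _).le) (intervalIntegrable_exp_neg hg_mono _ _)

/-- Bound for the gain of `integratedTail` under an upward jump `y`, seen from distance `s` below
the target. Near `s` the integrand is almost `exp (-g s)`. At distance between `K` and `s / 2` from
`s`, and at distance more than `s / 2`, the condition on the increments of `g` compares it with
`exp (-g s)`; in the last case the factor `exp (g y)` is paid for by the moment of the jump. -/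
theorem integral_exp_neg_jump_le {g : ℝ → ℝ} (hg_mono : Monotone g)
    {γ x₀ A K r s y η : ℝ} (hγ0 : 0 < γ)
    (hI : IntegrableOn (fun x => Real.exp (-(1 - γ) * g x)) (Ioi r))
    (hC3 : ∀ x y : ℝ, x₀ < y → y ≤ x / 2 → g x - g (x - y) ≤ γ * g y + A)
    (hη : 0 ≤ η)
    (hK : x₀ ≤ K) (hr : x₀ ≤ r) (hrs : r ≤ s) (hy : 0 ≤ y)
    (hloc : Real.exp (-g (s - K)) ≤ (1 + η) * Real.exp (-g s)) :
    ∫ t in (max (s - y) r)..s, Real.exp (-g t) ≤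
      Real.exp (-g s) * ((1 + η) * y + (Ioi K).indicator (fun y => y * Real.exp (A + γ * g y)) y +
        (∫ t in Ioi r, Real.exp (-(1 - γ) * g t)) * Real.exp (A + g y)) := by
  set J := (Ioi K).indicator (fun y => Real.exp (A + γ * g y)) y with hJ
  have hJ0 : 0 ≤ J := indicator_nonneg (fun _ _ => (Real.exp_pos _).le) _
  have hJy : (Ioi K).indicator (fun y => y * Real.exp (A + γ * g y)) y = y * J := by
    by_cases h : y ∈ Ioi K <;> simp [hJ, h]
  have hm : max (s - y) r ≤ s := max_le (by linarith) hrs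
  have hI' : IntegrableOn (fun x => Real.exp (-(1 - γ) * g x)) (Ioc (max (s - y) r) s) :=
    hI.mono_set fun t ht => (le_max_right _ _).trans_lt ht.1
  have hpt : ∀ t ∈ Ioc (max (s - y) r) s, Real.exp (-g t) ≤
      Real.exp (-g s) * ((1 + η) + J) +
        Real.exp (-g s) * Real.exp (A + g y) * Real.exp (-(1 - γ) * g t) := by
    rintro t ⟨h1, h2⟩
    obtain ⟨h3, h4⟩ := max_lt_iff.1 h1
    have p1 := Real.exp_pos (-g s)
    have p2 := Real.exp_pos (A + g y)
    have p3 := Real.exp_pos (-(1 - γ) * g t)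
    rcases le_or_gt (s - t) K with hc | hc
    · have : Real.exp (-g t) ≤ Real.exp (-g (s - K)) :=
        antitone_exp_neg hg_mono (by linarith)
      nlinarith [mul_nonneg p1.le hJ0, mul_pos (mul_pos p1 p2) p3]
    · rcases le_or_gt (s - t) (s / 2) with hc2 | hc2
      · have h5 := hC3 s (s - t) (by linarith) hc2
        rw [sub_sub_cancel] at h5
        have h6 : g (s - t) ≤ g y := hg_mono (by linarith)
        have h7 : J = Real.exp (A + γ * g y) := indicator_of_mem (by simp; linarith) _
        have : Real.exp (-g t) ≤ Real.exp (-g s) * J := by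
          rw [h7, ← Real.exp_add, Real.exp_le_exp]
          nlinarith
        nlinarith [mul_pos (mul_pos p1 p2) p3, mul_nonneg p1.le hη]
      · have h5 := hC3 s t (by linarith) (by linarith)
        have h6 : g (s - t) ≤ g y := hg_mono (by linarith)
        have : Real.exp (-g t) ≤
            Real.exp (-g s) * Real.exp (A + g y) * Real.exp (-(1 - γ) * g t) := by
          rw [← Real.exp_add, ← Real.exp_add, Real.exp_le_exp]
          nlinarith
        nlinarith [mul_nonneg p1.le hJ0, mul_nonneg p1.le hη]
  rw [intervalIntegral.integral_of_le hm, hJy]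
  calc ∫ t in Ioc (max (s - y) r) s, Real.exp (-g t)
      ≤ ∫ t in Ioc (max (s - y) r) s, (Real.exp (-g s) * ((1 + η) + J) +
        Real.exp (-g s) * Real.exp (A + g y) * Real.exp (-(1 - γ) * g t)) :=
        setIntegral_mono_on (intervalIntegrable_exp_neg hg_mono _ _).1
          ((integrable_const _).add (hI'.const_mul _)) measurableSet_Ioc hpt
    _ = (s - max (s - y) r) * (Real.exp (-g s) * ((1 + η) + J)) +
        Real.exp (-g s) * Real.exp (A + g y) *
          ∫ t in Ioc (max (s - y) r) s, Real.exp (-(1 - γ) * g t) := by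
        rw [integral_add (integrable_const _) (hI'.const_mul _), setIntegral_const,
          integral_const_mul, Measure.real, Real.volume_Ioc,
          ENNReal.toReal_ofReal (by linarith), smul_eq_mul]
    _ ≤ y * (Real.exp (-g s) * ((1 + η) + J)) +
        Real.exp (-g s) * Real.exp (A + g y) * ∫ t in Ioi r, Real.exp (-(1 - γ) * g t) := by
        gcongr
        · linarith [le_max_left (s - y) r]
        · exact ae_of_all _ fun _ => (Real.exp_pos _).le
        · exact fun t ht => (le_max_right _ _).trans_lt ht.1
    _ = _ := by ring

/-- Bound, up to the factor `exp (-g s)`, for the change of `integratedTail` under a jump `y`, when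
jumps below `K` are treated as local, drops are counted up to `L`, and `η` is the relative error of
treating `exp (-g)` as locally constant. -/
noncomputable def jumpBound (g : ℝ → ℝ) (γ A K r L η y : ℝ) : ℝ :=
  (1 + η) * max y 0 + (Ioi K).indicator (fun y => y * Real.exp (A + γ * g y)) y +
    (∫ t in Ioi r, Real.exp (-(1 - γ) * g t)) * Real.exp (A + g y) -
    (1 - η) * min (max (-y) 0) L

theorem integratedTail_add_sub_le {g : ℝ → ℝ} (hg_mono : Monotone g)
    {γ x₀ A K r L u x y η : ℝ} (hγ0 : 0 < γ)
    (hI : IntegrableOn (fun x => Real.exp (-(1 - γ) * g x)) (Ioi r))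
    (hC3 : ∀ x y : ℝ, x₀ < y → y ≤ x / 2 → g x - g (x - y) ≤ γ * g y + A)
    (hK0 : 0 ≤ K) (hη : 0 ≤ η) (hL : 0 ≤ L)
    (hK : x₀ ≤ K) (hr : x₀ ≤ r) (hu : 0 ≤ u) (hrs : r ≤ x - u)
    (hloc : Real.exp (-g (x - u - K)) ≤ (1 + η) * Real.exp (-g (x - u)))
    (hloc' : (1 - η) * Real.exp (-g (x - u)) ≤ Real.exp (-g (x - u + L))) :
    integratedTail g r (x + L) x (u + y) - integratedTail g r (x + L) x u ≤
      Real.exp (-g (x - u)) * jumpBound g γ A K r L η y := by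
  rw [integratedTail_sub hg_mono]
  have e1 : min (max (x - u) r) (x + L) = x - u := by
    rw [max_eq_left hrs, min_eq_left (by linarith)]
  rw [e1]
  set s := x - u with hs
  have hκ : 0 ≤ ∫ t in Ioi r, Real.exp (-(1 - γ) * g t) :=
    integral_nonneg fun _ => (Real.exp_pos _).le
  rcases le_total 0 y with hy | hy
  · have e2 : min (max (x - (u + y)) r) (x + L) = max (s - y) r := by
      rw [min_eq_left (max_le (by linarith) (by linarith))]
      congr 1; rw [hs]; ring
    rw [e2]
    refine (integral_exp_neg_jump_le hg_mono hγ0 hI hC3 hη hK hr hrs hy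
      hloc).trans_eq ?_
    rw [jumpBound, max_eq_left hy, max_eq_right (by linarith : -y ≤ 0), min_eq_left hL]
    ring
  · have e2 : min (max (x - (u + y)) r) (x + L) = min (s + -y) (x + L) := by
      rw [max_eq_left (by linarith)]
      congr 1; rw [hs]; ring
    rw [e2, intervalIntegral.integral_symm]
    have h1 : s + min (-y) L ≤ min (s + -y) (x + L) := by
      refine le_min ?_ ?_
      · linarith [min_le_left (-y) L]
      · linarith [min_le_right (-y) L]
    have h2 : 0 ≤ min (-y) L := le_min (by linarith) hL
    have h3 : min (-y) L * Real.exp (-g (s + L)) ≤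
        ∫ t in s..min (s + -y) (x + L), Real.exp (-g t) := by
      calc min (-y) L * Real.exp (-g (s + L))
          = ∫ _ in s..(s + min (-y) L), Real.exp (-g (s + L)) := by simp
        _ ≤ ∫ t in s..(s + min (-y) L), Real.exp (-g t) := by
          refine intervalIntegral.integral_mono_on (by linarith) (by simp)
            (intervalIntegrable_exp_neg hg_mono _ _) fun t ht => antitone_exp_neg hg_mono ?_
          linarith [ht.2, min_le_right (-y) L]
        _ ≤ _ := intervalIntegral.integral_mono_interval le_rfl (by linarith) h1
          (ae_of_all _ fun _ => (Real.exp_pos _).le) (intervalIntegrable_exp_neg hg_mono _ _)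
    have h4 : y ∉ Ioi K := by simp; linarith
    rw [jumpBound, max_eq_right hy, max_eq_left (by linarith : 0 ≤ -y), indicator_of_notMem h4]
    have h5 := mul_le_mul_of_nonneg_left hloc' h2
    have h6 := mul_nonneg (Real.exp_pos (-g s)).le (mul_nonneg hκ (Real.exp_pos (A + g y)).le)
    nlinarith

variable {Ω : Type*} [MeasurableSpace Ω] {μ : Measure Ω}

/-- As the parameters of `jumpBound` go to their limits, its expectation tends to that of the jump
itself, by dominated convergence. -/
theorem tendsto_integral_jumpBound {X : Ω → ℝ} (hXm : Measurable X) (hX : Integrable X μ)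
    {g : ℝ → ℝ} (hg_mono : Monotone g)
    {γ A : ℝ} (hγ1 : γ < 1)
    (hI : IntegrableOn (fun x => Real.exp (-(1 - γ) * g x)) (Ioi 1))
    (hgX : Integrable (fun ω => Real.exp (g (X ω))) μ) :
    Tendsto (fun n : ℕ => ∫ ω, jumpBound g γ A n n n (1 / ((n : ℝ) + 1)) (X ω) ∂μ) atTop
      (𝓝 (∫ ω, X ω ∂μ)) := by
  obtain ⟨C, hC, hCy⟩ := exists_forall_le_mul_exp hg_mono (sub_pos.2 hγ1) hI
  set κ : ℕ → ℝ := fun n => ∫ t in Ioi (n : ℝ), Real.exp (-(1 - γ) * g t) with hκ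
  have hκ0 : Tendsto κ atTop (𝓝 0) := by
    have h := tendsto_setIntegral_of_antitone (μ := volume)
      (f := fun t => Real.exp (-(1 - γ) * g t)) (s := fun n : ℕ => Ioi (n : ℝ))
      (fun n => measurableSet_Ioi) (fun m n h => Ioi_subset_Ioi (by exact_mod_cast h))
      ⟨1, by simpa using hI⟩
    have he : ⋂ n : ℕ, Ioi (n : ℝ) = ∅ := by
      rw [eq_empty_iff_forall_notMem]
      intro x hx
      obtain ⟨n, hn⟩ := exists_nat_gt x
      exact absurd (mem_iInter.1 hx n) (not_lt.2 hn.le)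
    rwa [he, setIntegral_empty] at h
  have hgm : Measurable g := hg_mono.measurable
  have hdom : ∀ y, ∀ n : ℕ, 2 ≤ n → |jumpBound g γ A n n n (1 / ((n : ℝ) + 1)) y| ≤
      3 * |y| + (Real.exp A * C + κ 1 * Real.exp A) * Real.exp (g y) := by
    intro y n hn
    have hn2 : (2 : ℝ) ≤ n := by exact_mod_cast hn
    have h1 : κ n ≤ κ 1 := by
      refine setIntegral_mono_set (by simpa using hI) (ae_of_all _ fun _ => (Real.exp_pos _).le)
        (LE.le.eventuallyLE (Ioi_subset_Ioi ?_))
      push_cast; linarith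
    have h0 : 0 ≤ κ n := integral_nonneg fun _ => (Real.exp_pos _).le
    have h2 : 0 ≤ (Ioi (n : ℝ)).indicator (fun y => y * Real.exp (A + γ * g y)) y :=
      indicator_nonneg (fun y hy => mul_nonneg (by have := mem_Ioi.1 hy; linarith)
        (Real.exp_pos _).le) _
    have h3 : (Ioi (n : ℝ)).indicator (fun y => y * Real.exp (A + γ * g y)) y ≤
        Real.exp A * C * Real.exp (g y) := by
      by_cases h : y ∈ Ioi (n : ℝ)
      · rw [indicator_of_mem h]
        have hy := hCy y (by have := mem_Ioi.1 h; linarith)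
        calc y * Real.exp (A + γ * g y)
            ≤ C * Real.exp ((1 - γ) * g y) * Real.exp (A + γ * g y) := by gcongr
          _ = Real.exp A * C * (Real.exp ((1 - γ) * g y) * Real.exp (γ * g y)) := by
            rw [Real.exp_add]; ring
          _ = _ := by rw [← Real.exp_add]; ring_nf
      · rw [indicator_of_notMem h]
        positivity
    have h4 : 1 / ((n : ℝ) + 1) ≤ 1 := by
      rw [div_le_one (by positivity)]; linarith
    have h5 : 0 ≤ 1 / ((n : ℝ) + 1) := by positivity
    have h6 : 0 ≤ min (max (-y) 0) (n : ℝ) := le_min (le_max_right _ _) (by positivity)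
    have h7 : min (max (-y) 0) (n : ℝ) ≤ |y| := (min_le_left _ _).trans
      (max_le (neg_le_abs y) (abs_nonneg y))
    have h8 : max y 0 ≤ |y| := max_le (le_abs_self y) (abs_nonneg y)
    have h9 : 0 ≤ max y 0 := le_max_right _ _
    have h10 : κ n * Real.exp (A + g y) ≤ κ 1 * Real.exp A * Real.exp (g y) := by
      rw [Real.exp_add, ← mul_assoc]; gcongr
    have h11 : 0 ≤ κ n * Real.exp (A + g y) := by positivity
    have h12 : (1 + 1 / ((n : ℝ) + 1)) * max y 0 ≤ 2 * |y| := by gcongr; linarith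
    have h13 : 0 ≤ (1 + 1 / ((n : ℝ) + 1)) * max y 0 := by positivity
    have h14 : (1 - 1 / ((n : ℝ) + 1)) * min (max (-y) 0) (n : ℝ) ≤ 1 * |y| := by
      gcongr; linarith
    have h15 : 0 ≤ (1 - 1 / ((n : ℝ) + 1)) * min (max (-y) 0) (n : ℝ) :=
      mul_nonneg (by linarith) h6
    rw [jumpBound, abs_le]
    constructor <;> linarith
  refine tendsto_integral_filter_of_dominated_convergence
    (fun ω => 3 * |X ω| + (Real.exp A * C + κ 1 * Real.exp A) * Real.exp (g (X ω))) ?_ ?_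
    ((hX.abs.const_mul _).add (hgX.const_mul _)) ?_
  · refine Eventually.of_forall fun n => Measurable.aestronglyMeasurable ?_
    have hi : Measurable ((Ioi (n : ℝ)).indicator fun y => y * Real.exp (A + γ * g y)) :=
      Measurable.indicator (by fun_prop) measurableSet_Ioi
    unfold jumpBound
    fun_prop
  · filter_upwards [eventually_ge_atTop 2] with n hn
    exact ae_of_all _ fun ω => hdom _ n hn
  · refine ae_of_all _ fun ω => ?_
    set y := X ω
    have t1 : Tendsto (fun n : ℕ => (1 + 1 / ((n : ℝ) + 1)) * max y 0) atTop
        (𝓝 ((1 + 0) * max y 0)) :=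
      (tendsto_const_nhds.add tendsto_one_div_add_atTop_nhds_zero_nat).mul_const _
    have t2 : Tendsto (fun n : ℕ => (Ioi (n : ℝ)).indicator
        (fun y => y * Real.exp (A + γ * g y)) y) atTop (𝓝 0) := by
      refine tendsto_const_nhds.congr' ?_
      obtain ⟨N, hN⟩ := exists_nat_gt y
      filter_upwards [eventually_ge_atTop N] with n hn
      rw [indicator_of_notMem]
      have : (N : ℝ) ≤ n := by exact_mod_cast hn
      simp; linarith
    have t3 : Tendsto (fun n : ℕ => κ n * Real.exp (A + g y)) atTop
        (𝓝 (0 * Real.exp (A + g y))) := hκ0.mul_const _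
    have t4 : Tendsto (fun n : ℕ => (1 - 1 / ((n : ℝ) + 1)) * min (max (-y) 0) (n : ℝ)) atTop
        (𝓝 ((1 - 0) * max (-y) 0)) := by
      refine (tendsto_const_nhds.sub tendsto_one_div_add_atTop_nhds_zero_nat).mul ?_
      refine tendsto_const_nhds.congr' ?_
      filter_upwards [tendsto_natCast_atTop_atTop.eventually_ge_atTop (max (-y) 0)] with n hn
      rw [min_eq_left hn]
    have := ((t1.add t2).add t3).sub t4
    have hy : (1 + 0) * max y 0 + 0 + 0 * Real.exp (A + g y) - (1 - 0) * max (-y) 0 = y := by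
      rcases le_total 0 y with h | h
      · rw [max_eq_left h, max_eq_right (by linarith)]; ring
      · rw [max_eq_right h, max_eq_left (by linarith)]; ring
    rwa [hy] at this

/-- If the jump `X` has negative mean, suitable parameters make `integratedTail` superharmonic
at all positions `u ≥ 0` whose distance to the target `x` is at least a constant `R`. -/
theorem exists_integratedTail_superharmonic [IsProbabilityMeasure μ] {X : Ω → ℝ}
    (hXm : Measurable X) (hX : Integrable X μ) (hmean : ∫ ω, X ω ∂μ < 0)
    {g : ℝ → ℝ} (hg_mono : Monotone g)
    (hg_diff : ∀ᶠ x in atTop, DifferentiableAt ℝ g x)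
    (hg_deriv : Tendsto (deriv g) atTop (𝓝 0))
    {γ x₀ A : ℝ} (hγ0 : 0 < γ) (hγ1 : γ < 1)
    (hI : IntegrableOn (fun x => Real.exp (-(1 - γ) * g x)) (Ioi 1))
    (hC3 : ∀ x y : ℝ, x₀ < y → y ≤ x / 2 → g x - g (x - y) ≤ γ * g y + A)
    (hgX : Integrable (fun ω => Real.exp (g (X ω))) μ) (b : ℝ) :
    ∃ r L R : ℝ, 0 < L ∧ r ≤ R ∧ b ≤ R ∧ ∀ x u, 0 ≤ u → R ≤ x - u →
      ∫⁻ ω, ENNReal.ofReal (integratedTail g r (x + L) x (u + X ω)) ∂μ ≤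
        ENNReal.ofReal (integratedTail g r (x + L) x u) := by
  obtain ⟨n, hneg, hn1, hnx⟩ :=
    (((tendsto_integral_jumpBound (A := A) hXm hX hg_mono hγ1 hI hgX).eventually
      (gt_mem_nhds hmean)).and ((eventually_ge_atTop 1).and
      (tendsto_natCast_atTop_atTop.eventually_ge_atTop x₀))).exists
  have hn : (1 : ℝ) ≤ n := by exact_mod_cast hn1
  set η : ℝ := 1 / ((n : ℝ) + 1) with hηdef
  have hη : 0 < η := by positivity
  obtain ⟨T, hT⟩ := exists_forall_add_le_add_mul hg_diff hg_deriv
    (η := Real.log (1 + η) / n) (div_pos (Real.log_pos (by linarith)) (by linarith))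
  have hmul : Real.log (1 + η) / n * n = Real.log (1 + η) := by field_simp
  refine ⟨n, n, max (T + n) (max n b), by linarith, (le_max_left _ _).trans (le_max_right _ _),
    (le_max_right _ _).trans (le_max_right _ _), fun x u hu hR => ?_⟩
  have hR1 : T + n ≤ x - u := (le_max_left _ _).trans hR
  have hR2 : (n : ℝ) ≤ x - u := ((le_max_left _ _).trans (le_max_right _ _)).trans hR
  have hlog : 0 < 1 + η := by linarith
  have hloc : Real.exp (-g (x - u - n)) ≤ (1 + η) * Real.exp (-g (x - u)) := by
    have := hT (x - u - n) n (by linarith) (by linarith)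
    rw [sub_add_cancel, hmul] at this
    calc Real.exp (-g (x - u - n)) ≤ Real.exp (Real.log (1 + η) + -g (x - u)) := by
          rw [Real.exp_le_exp]
          linarith
      _ = _ := by rw [Real.exp_add, Real.exp_log hlog]
  have hloc' : (1 - η) * Real.exp (-g (x - u)) ≤ Real.exp (-g (x - u + n)) := by
    have := hT (x - u) n (by linarith) (by linarith)
    rw [hmul] at this
    calc (1 - η) * Real.exp (-g (x - u)) ≤ (1 + η)⁻¹ * Real.exp (-g (x - u)) := by
          gcongr
          rw [← one_div, le_div_iff₀ hlog]
          nlinarith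
      _ = Real.exp (-Real.log (1 + η) + -g (x - u)) := by
          rw [Real.exp_add, Real.exp_neg (Real.log _), Real.exp_log hlog]
      _ ≤ _ := by
          rw [Real.exp_le_exp]
          linarith
  have hWm : Measurable fun ω => integratedTail g n (x + n) x (u + X ω) :=
    (integratedTail_mono hg_mono _ _ _).measurable.comp (hXm.const_add u)
  have hWi : Integrable (fun ω => integratedTail g n (x + n) x (u + X ω)) μ :=
    Integrable.of_bound hWm.aestronglyMeasurable _ (ae_of_all _ fun ω => by
      rw [Real.norm_of_nonneg (integratedTail_nonneg _ _ _ _ _)]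
      exact integratedTail_le hg_mono _ _ _ _)
  -- the integral is nonzero, hence not the junk value
  have hJi : Integrable (fun ω => jumpBound g γ A n n n η (X ω)) μ :=
    not_imp_comm.1 integral_undef hneg.ne
  have hdrift : ∫ ω, integratedTail g n (x + n) x (u + X ω) ∂μ ≤
      integratedTail g n (x + n) x u := by
    have h1 : ∫ ω, integratedTail g n (x + n) x (u + X ω) ∂μ ≤
        ∫ ω, (integratedTail g n (x + n) x u +
          Real.exp (-g (x - u)) * jumpBound g γ A n n n η (X ω)) ∂μ := by
      refine integral_mono hWi ((integrable_const _).add (hJi.const_mul _)) fun ω => ?_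
      have := integratedTail_add_sub_le hg_mono hγ0
        (hI.mono_set (Ioi_subset_Ioi hn)) hC3 (by linarith) hη.le (by linarith) hnx hnx hu
        hR2 hloc hloc' (y := X ω)
      simp only
      linarith
    rw [integral_add (integrable_const _) (hJi.const_mul _), integral_const_mul] at h1
    simp only [integral_const, probReal_univ, one_smul] at h1
    have := mul_neg_of_pos_of_neg (Real.exp_pos (-g (x - u))) hneg
    linarith
  rw [← ofReal_integral_eq_lintegral_ofReal hWi
    (ae_of_all _ fun ω => integratedTail_nonneg _ _ _ _ _)]
  exact ENNReal.ofReal_le_ofReal hdrift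

theorem integratedTail_zero_le {g : ℝ → ℝ} (hg_mono : Monotone g) {r L x : ℝ} (hL : 0 ≤ L)
    (hr : r ≤ x) : integratedTail g r (x + L) x 0 ≤ L * Real.exp (-g x) := by
  rw [integratedTail, sub_zero, max_eq_left hr, min_eq_left (by linarith)]
  calc ∫ t in x..(x + L), Real.exp (-g t) ≤ ∫ _ in x..(x + L), Real.exp (-g x) :=
        intervalIntegral.integral_mono_on (by linarith) (intervalIntegrable_exp_neg hg_mono _ _)
          (by simp) fun t ht => antitone_exp_neg hg_mono ht.1
    _ = _ := by simp

theorem le_integratedTail {g : ℝ → ℝ} (hg_mono : Monotone g) {r L R x u : ℝ} (hL : 0 ≤ L)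
    (hr : r ≤ R) (hR : R ≤ x) (hu : x - R ≤ u) :
    L * Real.exp (-g (R + L)) ≤ integratedTail g r (x + L) x u := by
  have hm : min (max (x - u) r) (x + L) ≤ R := (min_le_left _ _).trans (max_le (by linarith) hr)
  calc L * Real.exp (-g (R + L)) = ∫ _ in R..(R + L), Real.exp (-g (R + L)) := by simp
    _ ≤ ∫ t in R..(R + L), Real.exp (-g t) :=
        intervalIntegral.integral_mono_on (by linarith) (by simp)
          (intervalIntegrable_exp_neg hg_mono _ _) fun t ht => antitone_exp_neg hg_mono ht.2
    _ ≤ _ := intervalIntegral.integral_mono_interval hm (by linarith) (by linarith)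
          (ae_of_all _ fun _ => (Real.exp_pos _).le) (intervalIntegrable_exp_neg hg_mono _ _)

end Drift

/-! ### The walk before its ladder epoch -/

section Walk

variable {Ω : Type*}

theorem ladderEpoch_le_iff (ξ : ℕ → Ω → ℝ) (ω : Ω) (n : ℕ) :
    ladderEpoch ξ ω ≤ n ↔ ∃ k, 1 ≤ k ∧ k ≤ n ∧ walk ξ k ω ≤ 0 := by
  constructor
  · intro h
    by_contra! hc
    have : ((n + 1 : ℕ) : ℕ∞) ≤ ladderEpoch ξ ω := by
      refine le_sInf ?_
      rintro _ ⟨k, ⟨hk, hw⟩, rfl⟩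
      simp only [Nat.cast_le]
      by_contra! hkn
      exact absurd hw (not_le.2 (hc k hk (by omega)))
    have := this.trans h
    rw [Nat.cast_le] at this
    omega
  · rintro ⟨k, hk, hkn, hw⟩
    exact (sInf_le ⟨k, ⟨hk, hw⟩, rfl⟩ : ladderEpoch ξ ω ≤ k).trans (by exact_mod_cast hkn)

theorem lt_ladderEpoch_iff (ξ : ℕ → Ω → ℝ) (ω : Ω) (n : ℕ) :
    (n : ℕ∞) < ladderEpoch ξ ω ↔ ∀ k, 1 ≤ k → k ≤ n → 0 < walk ξ k ω := by
  rw [← not_le, ladderEpoch_le_iff]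
  push Not
  rfl

theorem measurable_walk {m : MeasurableSpace Ω} {ξ : ℕ → Ω → ℝ} {k : ℕ}
    (h : ∀ i < k, Measurable[m] (ξ i)) : Measurable[m] (walk ξ k) := by
  unfold walk
  exact Finset.measurable_sum _ fun i hi => h i (Finset.mem_range.1 hi)

theorem walk_succ (ξ : ℕ → Ω → ℝ) (k : ℕ) (ω : Ω) :
    walk ξ (k + 1) ω = walk ξ k ω + ξ k ω := by
  simp [walk, Finset.sum_range_succ]

/-- The σ-algebra generated by the first `k` increments `ξ 0, …, ξ (k - 1)`. -/
abbrev pastSigma (ξ : ℕ → Ω → ℝ) (k : ℕ) : MeasurableSpace Ω :=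
  ⨆ i ∈ Iio k, MeasurableSpace.comap (ξ i) inferInstance

theorem measurable_walk_pastSigma (ξ : ℕ → Ω → ℝ) {j k : ℕ} (hjk : j ≤ k) :
    Measurable[pastSigma ξ k] (walk ξ j) :=
  measurable_walk fun i hi => (comap_measurable (ξ i)).mono
    (le_iSup₂_of_le (f := fun i (_ : i ∈ Iio k) => MeasurableSpace.comap (ξ i) inferInstance)
      i (hi.trans_le hjk) le_rfl) le_rfl

variable [MeasurableSpace Ω] {μ : Measure Ω}

theorem pastSigma_le {ξ : ℕ → Ω → ℝ} (hmeas : ∀ n, Measurable (ξ n)) (k : ℕ) :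
    pastSigma ξ k ≤ ‹MeasurableSpace Ω› :=
  iSup₂_le fun i _ => (hmeas i).comap_le

/-- One step of the walk integrated out: the next increment is independent of the past, and an
event `A` of the past can be carried along. -/
theorem setLIntegral_walk_succ [IsProbabilityMeasure μ] {ξ : ℕ → Ω → ℝ}
    (hmeas : ∀ n, Measurable (ξ n))
    (hindep : iIndepFun ξ μ) (hident : ∀ n, IdentDistrib (ξ n) (ξ 0) μ μ) (k : ℕ) {A : Set Ω}
    (hA : MeasurableSet[pastSigma ξ k] A)
    {F : ℝ → ℝ → ℝ≥0∞} (hF : Measurable (Function.uncurry F)) :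
    ∫⁻ ω in A, F (walk ξ k ω) (ξ k ω) ∂μ =
      ∫⁻ ω in A, ∫⁻ ω', F (walk ξ k ω) (ξ 0 ω') ∂μ ∂μ := by
  have hle := pastSigma_le hmeas k
  have hw := measurable_walk_pastSigma ξ (le_refl k)
  have hind : Indep (pastSigma ξ k) (MeasurableSpace.comap (ξ k) inferInstance) μ := by
    have := indep_iSup_of_disjoint (fun i => (hmeas i).comap_le) hindep.iIndep
      (S := Iio k) (T := {k}) (by simp)
    simpa [pastSigma] using this
  -- the past enters through the pair consisting of the position and the indicator of `A`
  set X : Ω → ℝ × ℝ≥0∞ := fun ω => (walk ξ k ω, A.indicator (fun _ => 1) ω)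
  have hXm : Measurable[pastSigma ξ k] X := hw.prodMk
    ((measurable_const : Measurable[pastSigma ξ k] fun _ => (1 : ℝ≥0∞)).indicator hA)
  have hX : Measurable X := hXm.mono hle le_rfl
  have hXY : IndepFun X (ξ k) μ := by
    rw [IndepFun_iff_Indep]
    exact indep_of_indep_of_le_left hind hXm.comap_le
  have hG : Measurable fun p : (ℝ × ℝ≥0∞) × ℝ => p.1.2 * F p.1.1 p.2 := by
    have : Measurable fun p : (ℝ × ℝ≥0∞) × ℝ => F p.1.1 p.2 :=
      hF.comp ((measurable_fst.comp measurable_fst).prodMk measurable_snd)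
    exact (measurable_snd.comp measurable_fst).mul this
  rw [← lintegral_indicator (hle _ hA), ← lintegral_indicator (hle _ hA)]
  calc ∫⁻ ω, A.indicator (fun ω => F (walk ξ k ω) (ξ k ω)) ω ∂μ
      = ∫⁻ ω, (fun p : (ℝ × ℝ≥0∞) × ℝ => p.1.2 * F p.1.1 p.2) (X ω, ξ k ω) ∂μ := by
        refine lintegral_congr fun ω => ?_
        by_cases h : ω ∈ A <;> simp [X, h]
    _ = ∫⁻ p, p.1.2 * F p.1.1 p.2 ∂((μ.map X).prod (μ.map (ξ 0))) := by
        rw [← (hident k).map_eq,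
          ← (indepFun_iff_map_prod_eq_prod_map_map hX.aemeasurable (hmeas k).aemeasurable).1 hXY,
          lintegral_map hG (hX.prodMk (hmeas k))]
    _ = ∫⁻ ω, ∫⁻ ω', (X ω).2 * F (X ω).1 (ξ 0 ω') ∂μ ∂μ := by
        have : IsProbabilityMeasure (μ.map (ξ 0)) :=
          Measure.isProbabilityMeasure_map (hmeas 0).aemeasurable
        rw [lintegral_prod _ hG.aemeasurable, lintegral_map hG.lintegral_prod_right' hX]
        refine lintegral_congr fun ω => ?_
        exact lintegral_map (hG.comp (measurable_const.prodMk measurable_id)) (hmeas 0)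
    _ = _ := by
        refine lintegral_congr fun ω => ?_
        by_cases h : ω ∈ A <;> simp [X, h]

/-- Maximal inequality for the walk with extra drift `b`: if `V` is superharmonic for it on `[0, θ)`
and at least `c` on `[θ, ∞)`, where `θ ≤ b n`, then, with probability at most `V 0 / c`, the
undrifted walk is positive up to time `n`. Indeed, on this event, the drifted walk reaches
`[θ, ∞)` by time `n` without leaving `[0, ∞)`. -/
theorem mul_measure_walk_pos_le [IsProbabilityMeasure μ] {ξ : ℕ → Ω → ℝ}
    (hmeas : ∀ n, Measurable (ξ n))
    (hindep : iIndepFun ξ μ) (hident : ∀ n, IdentDistrib (ξ n) (ξ 0) μ μ)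
    {b θ : ℝ} (hb : 0 ≤ b) {V : ℝ → ℝ≥0∞} (hV : Measurable V) {c : ℝ≥0∞}
    (hsup : ∀ u, 0 ≤ u → u < θ → ∫⁻ ω, V (u + (ξ 0 ω + b)) ∂μ ≤ V u)
    (hc : ∀ u, θ ≤ u → c ≤ V u) (hθ : 0 < θ) {n : ℕ} (hn : 1 ≤ n) (hbn : θ ≤ b * n) :
    c * μ {ω | ∀ k, 1 ≤ k → k ≤ n → 0 < walk ξ k ω} ≤ V 0 := by
  set U : ℕ → Ω → ℝ := fun k ω => walk ξ k ω + b * k with hU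
  set E : ℕ → Set Ω := fun n => {ω | ∀ k, 1 ≤ k → k ≤ n → 0 < walk ξ k ω} with hE
  set A : ℕ → Set Ω := fun n => {ω | ∀ k, 1 ≤ k → k ≤ n → 0 < walk ξ k ω ∧ U k ω < θ} with hA
  have hUs (k : ℕ) (ω : Ω) : U (k + 1) ω = U k ω + (ξ k ω + b) := by
    simp only [hU, walk_succ]; push_cast; ring
  have hUm (k : ℕ) : Measurable (U k) := (measurable_walk fun i _ => hmeas i).add_const _
  have hAm (k : ℕ) :
      MeasurableSet[pastSigma ξ k] (A k) := by
    simp only [hA, ofPred_forall]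
    refine MeasurableSet.iInter fun j => MeasurableSet.iInter fun _ =>
      MeasurableSet.iInter fun hj => ?_
    have hw := measurable_walk_pastSigma ξ hj
    exact (hw measurableSet_Ioi).inter ((hw.add_const _) measurableSet_Iio)
  have hAm' (k : ℕ) : MeasurableSet (A k) := pastSigma_le hmeas k _ (hAm k)
  have key (k : ℕ) : c * μ (E k \ A k) + ∫⁻ ω in A k, V (U k ω) ∂μ ≤ V 0 := by
    induction k with
    | zero =>
      have h1 : E 0 = univ := by ext ω; simp only [hE, mem_ofPred_eq, mem_univ, iff_true]; omega
      have h2 : A 0 = univ := by ext ω; simp only [hA, mem_ofPred_eq, mem_univ, iff_true]; omega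
      simp [h1, h2, hU, walk]
    | succ k ih =>
      have hstep : ∫⁻ ω in A k, V (U (k + 1) ω) ∂μ ≤ ∫⁻ ω in A k, V (U k ω) ∂μ := by
        have := setLIntegral_walk_succ hmeas hindep hident k (hAm k)
          (F := fun w y => V (w + b * k + (y + b))) (hV.comp (by fun_prop))
        simp only [hUs]
        refine this.trans_le ?_
        refine setLIntegral_mono' (hAm' k) fun ω hω => hsup _ ?_ ?_
        · rcases Nat.eq_zero_or_pos k with rfl | hk
          · simp [walk]
          · have := (hω k hk le_rfl).1
            positivity
        · rcases Nat.eq_zero_or_pos k with rfl | hk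
          · simpa [walk] using hθ
          · exact (hω k hk le_rfl).2
      set B : Set Ω := {ω | θ ≤ U (k + 1) ω}
      have hB : MeasurableSet B := measurableSet_le measurable_const (hUm _)
      have hEA : E (k + 1) \ A (k + 1) ⊆ (E k \ A k) ∪ (A k ∩ B) := by
        rintro ω ⟨h1, h2⟩
        by_cases h : ω ∈ A k
        · refine Or.inr ⟨h, ?_⟩
          by_contra hc
          refine h2 fun j hj hjk => ?_
          rcases Nat.lt_or_ge k j with h' | h'
          · obtain rfl : j = k + 1 := by omega
            exact ⟨h1 _ hj le_rfl, not_le.1 hc⟩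
          · exact h j hj h'
        · exact Or.inl ⟨fun j hj hjk => h1 j hj (by omega), h⟩
      have hAA : A (k + 1) ⊆ A k \ B := fun ω h =>
        ⟨fun j hj hjk => h j hj (by omega), not_le.2 (h (k + 1) (by omega) le_rfl).2⟩
      have hcB : c * μ (A k ∩ B) ≤ ∫⁻ ω in A k ∩ B, V (U (k + 1) ω) ∂μ := by
        rw [← setLIntegral_const]
        exact setLIntegral_mono' ((hAm' k).inter hB) fun ω hω => hc _ hω.2
      calc c * μ (E (k + 1) \ A (k + 1)) + ∫⁻ ω in A (k + 1), V (U (k + 1) ω) ∂μ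
          ≤ c * (μ (E k \ A k) + μ (A k ∩ B)) + ∫⁻ ω in A k \ B, V (U (k + 1) ω) ∂μ := by
            gcongr
            exact (measure_mono hEA).trans (measure_union_le _ _)
        _ ≤ c * μ (E k \ A k) + (∫⁻ ω in A k ∩ B, V (U (k + 1) ω) ∂μ
              + ∫⁻ ω in A k \ B, V (U (k + 1) ω) ∂μ) := by
            rw [mul_add, add_assoc]
            gcongr
        _ = c * μ (E k \ A k) + ∫⁻ ω in A k, V (U (k + 1) ω) ∂μ := by
            rw [lintegral_inter_add_sdiff _ _ hB]
        _ ≤ c * μ (E k \ A k) + ∫⁻ ω in A k, V (U k ω) ∂μ := by gcongr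
        _ ≤ V 0 := ih
  have hAn : A n = ∅ := by
    rw [eq_empty_iff_forall_notMem]
    intro ω hω
    obtain ⟨h1, h2⟩ := hω n hn le_rfl
    simp only [hU] at h2
    linarith
  have := key n
  rw [hAn, sdiff_empty] at this
  simpa using this

end Walk

/-! ### Tail and moments of the ladder epoch -/

section Tail

variable {Ω : Type*} [MeasurableSpace Ω] {μ : Measure Ω}

theorem lintegral_exp_mul_lt_top {Z : Ω → ℝ} (hZ : ∀ ω, 0 ≤ Z ω) {C : ℝ}
    (h : ∀ k : ℕ, μ {ω | k ≤ Z ω} ≤ ENNReal.ofReal (C * Real.exp (-k))) {p : ℝ} (hp0 : 0 ≤ p)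
    (hp1 : p < 1) : ∫⁻ ω, ENNReal.ofReal (Real.exp (p * Z ω)) ∂μ < ∞ := by
  -- measurable hulls of the level sets make measurability of `Z` unnecessary
  set T : ℕ → Set Ω := fun k => toMeasurable μ {ω | k ≤ Z ω} with hT
  have hTm (k : ℕ) : MeasurableSet (T k) := measurableSet_toMeasurable _ _
  have hpt (ω : Ω) : ENNReal.ofReal (Real.exp (p * Z ω)) ≤
      ∑' k : ℕ, (T k).indicator (fun _ => ENNReal.ofReal (Real.exp (p * (k + 1)))) ω := by
    refine le_trans ?_ (ENNReal.le_tsum ⌊Z ω⌋₊)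
    have hmem : ω ∈ T ⌊Z ω⌋₊ := subset_toMeasurable _ _ (Nat.floor_le (hZ ω))
    rw [indicator_of_mem hmem]
    have := (Nat.lt_floor_add_one (Z ω)).le
    gcongr
  have hterm (k : ℕ) : ENNReal.ofReal (Real.exp (p * (k + 1))) * μ (T k) ≤
      ENNReal.ofReal (C * Real.exp p * Real.exp (p - 1) ^ k) := by
    rw [hT, measure_toMeasurable]
    calc ENNReal.ofReal (Real.exp (p * (k + 1))) * μ {ω | k ≤ Z ω}
        ≤ ENNReal.ofReal (Real.exp (p * (k + 1))) * ENNReal.ofReal (C * Real.exp (-k)) := by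
          gcongr; exact h k
      _ = ENNReal.ofReal (C * (Real.exp (p * (k + 1)) * Real.exp (-k))) := by
          rw [← ENNReal.ofReal_mul (Real.exp_pos _).le]; ring_nf
      _ = _ := by
          rw [mul_assoc C, ← Real.exp_nat_mul, ← Real.exp_add, ← Real.exp_add]; ring_nf
  have hsum : Summable fun k : ℕ => C * Real.exp p * Real.exp (p - 1) ^ k :=
    (summable_geometric_of_lt_one (Real.exp_pos _).le
      (Real.exp_lt_one_iff.2 (by linarith))).mul_left _
  calc ∫⁻ ω, ENNReal.ofReal (Real.exp (p * Z ω)) ∂μ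
      ≤ ∫⁻ ω, ∑' k : ℕ, (T k).indicator
          (fun _ => ENNReal.ofReal (Real.exp (p * (k + 1)))) ω ∂μ := lintegral_mono hpt
    _ = ∑' k : ℕ, ENNReal.ofReal (Real.exp (p * (k + 1))) * μ (T k) := by
        rw [lintegral_tsum fun k => (measurable_const.indicator (hTm k)).aemeasurable]
        exact tsum_congr fun k => lintegral_indicator_const (hTm k) _
    _ ≤ ∑' k : ℕ, ENNReal.ofReal (C * Real.exp p * Real.exp (p - 1) ^ k) :=
        ENNReal.tsum_le_tsum hterm
    _ < ∞ := hsum.tsum_ofReal_lt_top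

/-- Tail bound for the ladder epoch: at speed `b < a` its tail is at most of order `exp (-g)`,
without loss of a factor `1 - ε` in the exponent. -/
theorem exists_measure_le_ladderEpoch_le [IsProbabilityMeasure μ]
    {ξ : ℕ → Ω → ℝ} (hmeas : ∀ n, Measurable (ξ n))
    (hindep : iIndepFun ξ μ) (hident : ∀ n, IdentDistrib (ξ n) (ξ 0) μ μ)
    {a b : ℝ} (hb : 0 < b) (hba : b < a) (hint : Integrable (ξ 0) μ)
    (hmean : ∫ ω, ξ 0 ω ∂μ = -a)
    {g : ℝ → ℝ} (hg_nonneg : ∀ x, 0 ≤ g x) (hg_mono : Monotone g)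
    (hg_diff : ∀ᶠ x in atTop, DifferentiableAt ℝ g x)
    (hg_deriv : Tendsto (deriv g) atTop (𝓝 0))
    {γ x₀ A : ℝ} (hγ0 : 0 < γ) (hγ1 : γ < 1)
    (hI : IntegrableOn (fun x => Real.exp (-(1 - γ) * g x)) (Ioi 1))
    (hC3 : ∀ x y : ℝ, x₀ < y → y ≤ x / 2 → g x - g (x - y) ≤ γ * g y + A)
    (hmoment : Integrable (fun ω => Real.exp (g (ξ 0 ω))) μ) :
    ∃ C : ℝ, 0 < C ∧ ∀ m : ℕ, μ {ω | (m : ℕ∞) ≤ ladderEpoch ξ ω} ≤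
      ENNReal.ofReal (C * Real.exp (-g (b * m))) := by
  have hgm : Measurable g := hg_mono.measurable
  obtain ⟨D, hD⟩ := exists_forall_add_le_add_const hg_nonneg hg_mono hg_diff hg_deriv hb.le
  have hXm : Measurable fun ω => ξ 0 ω + b := (hmeas 0).add_const b
  have hX : Integrable (fun ω => ξ 0 ω + b) μ := hint.add (integrable_const b)
  have hXmean : ∫ ω, (ξ 0 ω + b) ∂μ < 0 := by
    rw [integral_add hint (integrable_const b), hmean]
    simp only [integral_const, probReal_univ, one_smul]
    linarith
  have hgX : Integrable (fun ω => Real.exp (g (ξ 0 ω + b))) μ := by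
    refine (hmoment.const_mul (Real.exp D)).mono'
      (hgm.comp hXm).exp.aestronglyMeasurable (ae_of_all _ fun ω => ?_)
    rw [Real.norm_of_nonneg (Real.exp_pos _).le, ← Real.exp_add, Real.exp_le_exp]
    linarith [hD (ξ 0 ω)]
  obtain ⟨r, L, R, hL, hrR, hbR, hsup⟩ := exists_integratedTail_superharmonic hXm hX hXmean
    hg_mono hg_diff hg_deriv hγ0 hγ1 hI hC3 hgX b
  refine ⟨Real.exp (g (R + L)), Real.exp_pos _, fun m => ?_⟩
  rcases le_or_gt m 1 with hm | hm
  · refine prob_le_one.trans ?_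
    rw [← ENNReal.ofReal_one]
    refine ENNReal.ofReal_le_ofReal ?_
    have hm' : (m : ℝ) ≤ 1 := by exact_mod_cast hm
    have : g (b * m) ≤ g (R + L) := hg_mono (by nlinarith)
    rw [← Real.exp_add, Real.one_le_exp_iff]
    linarith
  · obtain ⟨n, rfl, hn⟩ : ∃ n, m = n + 1 ∧ 1 ≤ n := ⟨m - 1, by omega, by omega⟩
    have hn' : (1 : ℝ) ≤ n := by exact_mod_cast hn
    set x : ℝ := b * n + R with hx
    have hbn : 0 < b * n := by positivity
    have hmax := mul_measure_walk_pos_le hmeas hindep hident hb.le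
      (θ := b * n) (V := fun u => ENNReal.ofReal (integratedTail g r (x + L) x u))
      (integratedTail_mono hg_mono _ _ _).measurable.ennreal_ofReal
      (c := ENNReal.ofReal (L * Real.exp (-g (R + L))))
      (fun u hu hun => hsup x u hu (by linarith))
      (fun u hu => ENNReal.ofReal_le_ofReal
        (le_integratedTail hg_mono hL.le hrR (by linarith) (by linarith))) hbn hn le_rfl
    have hset : {ω | ((n + 1 : ℕ) : ℕ∞) ≤ ladderEpoch ξ ω} =
        {ω | ∀ k, 1 ≤ k → k ≤ n → 0 < walk ξ k ω} := by
      ext ω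
      rw [mem_ofPred_eq, mem_ofPred_eq, ← lt_ladderEpoch_iff, Nat.cast_add, Nat.cast_one]
      exact ENat.add_one_le_iff (ENat.natCast_ne_top n)
    rw [hset]
    have hc : 0 < L * Real.exp (-g (R + L)) := by positivity
    have h0 := hmax.trans (ENNReal.ofReal_le_ofReal
      (integratedTail_zero_le hg_mono hL.le (by linarith : r ≤ x)))
    rw [mul_comm, ← ENNReal.le_div_iff_mul_le (Or.inl (by simpa using hc))
      (Or.inl ENNReal.ofReal_ne_top), ← ENNReal.ofReal_div_of_pos hc] at h0
    refine h0.trans (ENNReal.ofReal_le_ofReal ?_)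
    have hgx : Real.exp (-g x) ≤ Real.exp (-g (b * (n + 1 : ℕ))) :=
      antitone_exp_neg hg_mono (by push_cast; linarith)
    rw [div_le_iff₀ hc]
    have he : Real.exp (g (R + L)) * Real.exp (-g (R + L)) = 1 := by
      rw [← Real.exp_add]; simp
    calc L * Real.exp (-g x) ≤ L * Real.exp (-g (b * (n + 1 : ℕ))) := by gcongr
      _ = L * Real.exp (-g (b * (n + 1 : ℕ))) *
          (Real.exp (g (R + L)) * Real.exp (-g (R + L))) := by rw [he, mul_one]
      _ = _ := by ring

end Tail

theorem theorem1 {Ω : Type*} [MeasurableSpace Ω] (μ : Measure Ω) [IsProbabilityMeasure μ]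
    (ξ : ℕ → Ω → ℝ) (hmeas : ∀ n, Measurable (ξ n))
    (hindep : iIndepFun ξ μ) (hident : ∀ n, IdentDistrib (ξ n) (ξ 0) μ μ)
    (a : ℝ) (ha : 0 < a) (hint : Integrable (ξ 0) μ) (hmean : ∫ ω, ξ 0 ω ∂μ = -a)
    (hheavy : ∀ c : ℝ, 0 < c → ∫⁻ ω, ENNReal.ofReal (Real.exp (c * ξ 0 ω)) ∂μ = ∞)
    (g : ℝ → ℝ) (hg_nonneg : ∀ x, 0 ≤ g x) (hg_mono : Monotone g)
    (hg_diff : ∀ᶠ x in atTop, DifferentiableAt ℝ g x)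
    (hg_deriv : Tendsto (deriv g) atTop (𝓝 0))
    (hg_C3 : ∃ γ : ℝ, 0 < γ ∧ γ < 1 ∧
      IntegrableOn (fun x => Real.exp (-(1 - γ) * g x)) (Ioi 1) ∧
      ∃ x₀ A : ℝ, 0 < x₀ ∧ 0 < A ∧
        ∀ x y : ℝ, x₀ < y → y ≤ x / 2 → g x - g (x - y) ≤ γ * g y + A)
    (hmoment : ∫⁻ ω, ENNReal.ofReal (Real.exp (g (ξ 0 ω))) ∂μ < ∞) :
    (∀ᵐ ω ∂μ, ladderEpoch ξ ω ≠ ⊤) ∧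
      ∀ ε δ : ℝ, 0 < ε → ε < 1 → 0 < δ → δ < a →
        ∫⁻ ω, ENNReal.ofReal
          (Real.exp ((1 - ε) * g ((a - δ) * ((ladderEpoch ξ ω).toNat : ℝ)))) ∂μ < ∞ := by
  obtain ⟨γ, hγ0, hγ1, hI, x₀, A, -, -, hC3⟩ := hg_C3
  have hgm : Measurable g := hg_mono.measurable
  have hmoment' : Integrable (fun ω => Real.exp (g (ξ 0 ω))) μ := by
    refine ⟨(hgm.comp (hmeas 0)).exp.aestronglyMeasurable, ?_⟩
    rwa [hasFiniteIntegral_iff_ofReal (ae_of_all _ fun _ => (Real.exp_pos _).le)]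
  have htail : ∀ b, 0 < b → b < a → _ := fun b hb hba =>
    exists_measure_le_ladderEpoch_le hmeas hindep hident hb hba hint hmean hg_nonneg hg_mono
      hg_diff hg_deriv hγ0 hγ1 hI hC3 hmoment'
  have hfin : ∀ᵐ ω ∂μ, ladderEpoch ξ ω ≠ ⊤ := by
    obtain ⟨C, -, hC⟩ := htail (a / 2) (by linarith) (by linarith)
    have hlim : Tendsto (fun m : ℕ => ENNReal.ofReal (C * Real.exp (-g (a / 2 * m)))) atTop
        (𝓝 0) := by
      have h1 : Tendsto (fun m : ℕ => g (a / 2 * m)) atTop atTop :=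
        (tendsto_atTop_of_integrableOn_exp hg_mono (sub_pos.2 hγ1) hI).comp
          (tendsto_natCast_atTop_atTop.const_mul_atTop (by linarith))
      have h2 := (Real.tendsto_exp_neg_atTop_nhds_zero.comp h1).const_mul C
      simpa using ENNReal.tendsto_ofReal h2
    have hz : μ {ω | ladderEpoch ξ ω = ⊤} ≤ 0 := ge_of_tendsto' hlim fun m =>
      (measure_mono fun ω hω => by
        rw [mem_ofPred_eq] at hω ⊢; rw [hω]; exact le_top).trans (hC m)
    rw [ae_iff]
    simpa using hz
  refine ⟨hfin, fun ε δ hε0 hε1 hδ0 hδa => ?_⟩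
  obtain ⟨C, hC0, hC⟩ := htail (a - δ) (by linarith) (by linarith)
  refine lintegral_exp_mul_lt_top (C := C) (fun ω => hg_nonneg _) (fun k => ?_)
    (by linarith) (by linarith)
  by_cases hex : ∃ m : ℕ, (k : ℝ) ≤ g ((a - δ) * m)
  · -- by monotonicity of `g` the event is `m ≤ τ`, for the first index `m` at level `k`
    classical
    calc μ {ω | (k : ℝ) ≤ g ((a - δ) * ((ladderEpoch ξ ω).toNat : ℝ))}
        ≤ μ {ω | (Nat.find hex : ℕ∞) ≤ ladderEpoch ξ ω} := by
          refine measure_mono_ae ?_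
          filter_upwards [hfin] with ω hω h
          have := Nat.find_min' hex h
          exact (Nat.cast_le.2 this).trans (ENat.natCast_toNat hω).le
      _ ≤ _ := hC _
      _ ≤ _ := by
          have := Nat.find_spec hex
          gcongr
  · have : {ω | (k : ℝ) ≤ g ((a - δ) * ((ladderEpoch ξ ω).toNat : ℝ))} = ∅ :=
      eq_empty_of_forall_notMem fun ω hω => hex ⟨_, hω⟩
    simp [this]
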